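/- Let $\gamma_1,\gamma_2\ge 0$ with $\gamma_1+\gamma_2=1$, $P_1,P_2\in[0,1]$, $W>0$, and $0\le t_i'\le\gamma_i(1-P_i)$ for $i=1,2$. Put $$C=(t_1'+\gamma_1P_1)+W^2(t_2'+\gamma_2P_2),\qquad D_i=\gamma_i(1-P_i)-t_i'\quad(i=1,2),$$ $$g(x)=\frac{2}{\sqrt\pi}e^{-x^2},\qquad G(x)=\frac{2}{\sqrt\pi}\int_0^x e^{-y^2}\,dy,$$ and assume $C>0$ and $D_1+D_2>0$. Then the equation $$2C-\frac{g(x)D_1}{x\,G(x)}-\frac{W g(Wx)D_2}{x\,G(Wx)}=0$$ has exactly one solution $x_0$ in $(0,\infty)$, and the following holds. For a partition $\{1,\dots,n\}=K_1\sqcup K_2$ let $n_i=|K_i|$, $w_k=1$ for $k\in K_1$, $w_k=W$ for $k\in K_2$, and let $\mathrm{SP}=\{y\in\mathbb R^n:\sum_k w_k|y_k|\le 1\}$ be the skewed cross-polytope. For $L\subseteq\{1,\dots,n\}$ and signs $\sigma_k\in\{\pm1\}$ let $F_{L,\sigma}=\mathrm{conv}\{\sigma_k e_k/w_k: k\in L\}$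 be the corresponding face of $\mathrm{SP}$, and put $t_i=|L\cap K_i|-n_iP_i$. The external angle $\gamma(F,\mathrm{SP})$ of a face $F\ne\mathrm{SP}$ is the fraction of the unit sphere of the linear span of $c$ that is covered by $c$, where $c=\{u\in\mathbb R^n:\langle u,y\rangle\le\langle u,x\rangle\text{ for all }x\in F,\ y\in \mathrm{SP}\}$ is the cone of outward normals at $F$. For every sequence of such data $(n,K_1,K_2,L,\sigma)$ with $n\to\infty$, $n_i/n\to\gamma_i$ and $t_i/n\to t_i'$ for $i=1,2$ (in particular when $n_i=\gamma_i n$ and $t_i=t_i'n$ exactly), the external angle decays with exponent $$\lim\,-\frac1n\log\gamma(F_{L,\sigma},\mathrm{SP})=\psi_{\mathrm{ext}}:=Cx_0^2-D_1\log G(x_0)-D_2\log G(Wx_0).$$ -/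

import Mathlib

open Filter Topology MeasureTheory

noncomputable section

/-- The skewed cross-polytope `{y : ∑ wᵢ |yᵢ| ≤ 1}` in Euclidean space. -/
def skewedCrossPolytope {n : ℕ} (w : Fin n → ℝ) : Set (EuclideanSpace ℝ (Fin n)) :=
  {y | ∑ i, w i * |y i| ≤ 1}

/-- The face `conv {σᵢ eᵢ / wᵢ : i ∈ L}` of the skewed cross-polytope, supported on `L`
and with sign pattern `σ`. -/
def skewedFace {n : ℕ} (w : Fin n → ℝ) (L : Finset (Fin n)) (σ : Fin n → ℤˣ) :
    Set (EuclideanSpace ℝ (Fin n)) :=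
  convexHull ℝ ((fun i => EuclideanSpace.single i (((σ i : ℤ) : ℝ) / w i)) '' (L : Set (Fin n)))

/-- The cone of outward normals `u` to the hyperplanes that support `P` at `F`: the linear
functional `⟪u, ·⟫` attains its maximum over `P` at every point of `F`. -/
def outwardNormalCone {n : ℕ} (F P : Set (EuclideanSpace ℝ (Fin n))) :
    Set (EuclideanSpace ℝ (Fin n)) :=
  {u | ∀ x ∈ F, ∀ y ∈ P, inner ℝ u y ≤ inner ℝ u x}

/-- The surface measure of the unit sphere of a linear subspace `V`, induced by the Euclidean
volume of `V` itself (normalised on an orthonormal basis of `V`, not the restriction of the volume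
of the ambient space). -/
def subspaceSphereMeasure {n : ℕ} (V : Submodule ℝ (EuclideanSpace ℝ (Fin n))) :
    Measure (Metric.sphere (0 : V) 1) :=
  (volume : Measure V).toSphere

/-- The fraction of the unit sphere (of the linear span of `c`) that is covered by the cone `c`. -/
def sphereFraction {n : ℕ} (c : Set (EuclideanSpace ℝ (Fin n))) : ℝ :=
  (subspaceSphereMeasure (Submodule.span ℝ c)).real
      {u | ((u : Submodule.span ℝ c) : EuclideanSpace ℝ (Fin n)) ∈ c} /
    (subspaceSphereMeasure (Submodule.span ℝ c)).real Set.univ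

open Classical in
/-- The external angle `γ(F, P)`: the fraction of the sphere covered by the cone of outward
normals, with the conventions `γ(F, F) = 1` and `γ(F, P) = 0` if `F ⊈ P`. -/
def externalAngle {n : ℕ} (F P : Set (EuclideanSpace ℝ (Fin n))) : ℝ :=
  if F = P then 1 else if F ⊆ P then sphereFraction (outwardNormalCone F P) else 0

/-- The weights: `1` on `K₁` and `W` on the complement of `K₁`. -/
def twoWeights {n : ℕ} (K₁ : Finset (Fin n)) (W : ℝ) (i : Fin n) : ℝ :=
  if i ∈ K₁ then 1 else W

/-- The normalized error function `G(x) = (2/√π) ∫₀ˣ exp(-y²) dy`. -/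
def erfG (x : ℝ) : ℝ := 2 / √Real.pi * ∫ y in (0 : ℝ)..x, Real.exp (-y ^ 2)

/-- The density `g(x) = (2/√π) exp(-x²)` of `erfG`. -/
def erfDensity (x : ℝ) : ℝ := 2 / √Real.pi * Real.exp (-x ^ 2)

end

/-!
The outward normals at the face with support `L` form an isometric copy of the wedge
`{(a, y) | ∀ k ∉ L, |y k| ≤ v k * a}`, where `v k = w k / √A` and `A = ∑ k ∈ L, w k ^ 2`. The
fraction of the sphere covered by a cone is the Gaussian measure of the cone, so slicing the wedge
along `a = √A * s` shows that the external angle is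
`√(A / π) * ∫ s in Ioi 0, exp (-A * s ^ 2) * ∏ k ∉ L, G (w k * s)`. By Laplace's method, with all
exponents growing linearly in `n`, its rate of decay is the minimum over `x > 0` of
`C * x ^ 2 - ∑ i, D i * log (G (w i * x))`. The derivative of this function is
`x * (2 * C - ∑ i, w i * g (w i * x) * D i / (x * G (w i * x)))`, and the sum in it decreases
strictly from `∞` to `0`, since `g (x) / (x * G (x))` does. Hence there is exactly one critical
point, and it is the minimiser.
-/

/-! ### The error function -/

lemma hasDerivAt_erfG (x : ℝ) : HasDerivAt erfG (erfDensity x) x := by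
  have hc : Continuous fun y : ℝ => Real.exp (-y ^ 2) := by fun_prop
  exact (hc.integral_hasStrictDerivAt 0 x).hasDerivAt.const_mul _

lemma continuous_erfG : Continuous erfG :=
  continuous_iff_continuousAt.2 fun x => (hasDerivAt_erfG x).continuousAt

lemma erfDensity_pos (x : ℝ) : 0 < erfDensity x := by
  unfold erfDensity; positivity

lemma continuous_erfDensity : Continuous erfDensity := by
  unfold erfDensity; fun_prop

lemma antitoneOn_erfDensity : AntitoneOn erfDensity (Set.Ici 0) := by
  intro x hx y _ hxy
  have hx : 0 ≤ x := hx
  unfold erfDensity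
  gcongr

lemma strictMono_erfG : StrictMono erfG :=
  strictMono_of_deriv_pos fun x => by
    rw [(hasDerivAt_erfG x).deriv]
    exact erfDensity_pos x

lemma erfG_zero : erfG 0 = 0 := by simp [erfG]

lemma erfG_pos {x : ℝ} (hx : 0 < x) : 0 < erfG x :=
  erfG_zero ▸ strictMono_erfG hx

lemma integral_Icc_exp_neg_sq {a : ℝ} (ha : 0 ≤ a) :
    ∫ y in Set.Icc (-a) a, Real.exp (-y ^ 2) = √Real.pi * erfG a := by
  have hI : ∀ b c : ℝ, IntervalIntegrable (fun y => Real.exp (-y ^ 2)) volume b c := fun b c =>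
    (by fun_prop : Continuous fun y : ℝ => Real.exp (-y ^ 2)).intervalIntegrable b c
  have hneg : ∫ y in (-a)..0, Real.exp (-y ^ 2) = ∫ y in (0 : ℝ)..a, Real.exp (-y ^ 2) := by
    have h := intervalIntegral.integral_comp_neg (a := 0) (b := a) fun y => Real.exp (-y ^ 2)
    simp_rw [neg_sq, neg_zero] at h
    exact h.symm
  rw [integral_Icc_eq_integral_Ioc, ← intervalIntegral.integral_of_le (by linarith),
    ← intervalIntegral.integral_add_adjacent_intervals (hI (-a) 0) (hI 0 a), hneg, erfG]
  field_simp
  ring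

lemma integrable_exp_neg_sq : Integrable fun y : ℝ => Real.exp (-y ^ 2) := by
  simpa using integrable_exp_neg_mul_sq one_pos

lemma erfG_le_one (x : ℝ) : erfG x ≤ 1 := by
  wlog hx : 0 ≤ x generalizing x
  · exact (strictMono_erfG.monotone (le_of_not_ge hx)).trans (this 0 le_rfl)
  have hle : ∫ y in Set.Icc (-x) x, Real.exp (-y ^ 2) ≤ √Real.pi := by
    have htotal : ∫ y : ℝ, Real.exp (-y ^ 2) = √Real.pi := by simpa using integral_gaussian 1
    rw [← htotal]
    exact setIntegral_le_integral integrable_exp_neg_sq (ae_of_all _ fun y => (Real.exp_pos _).le)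
  rw [integral_Icc_exp_neg_sq hx] at hle
  exact le_of_mul_le_mul_left (by simpa using hle) (Real.sqrt_pos.2 Real.pi_pos)

lemma log_erfG_nonpos {x : ℝ} (hx : 0 ≤ x) : Real.log (erfG x) ≤ 0 :=
  Real.log_nonpos (erfG_zero ▸ strictMono_erfG.monotone hx) (erfG_le_one x)

/-! ### The saddle-point equation -/

/-- The ratio `g(x) / (x G(x))`: the logarithmic derivative of `G`, divided by `x`. -/
noncomputable def erfRatio (x : ℝ) : ℝ := erfDensity x / (x * erfG x)

lemma erfRatio_pos {x : ℝ} (hx : 0 < x) : 0 < erfRatio x :=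
  div_pos (erfDensity_pos x) (mul_pos hx (erfG_pos hx))

lemma strictAntiOn_erfRatio : StrictAntiOn erfRatio (Set.Ioi 0) := by
  intro x hx y _ hxy
  have hx : 0 < x := hx
  have hden : x * erfG x < y * erfG y :=
    mul_lt_mul'' hxy (strictMono_erfG hxy) hx.le (erfG_pos hx).le
  exact div_lt_div₀' (antitoneOn_erfDensity hx.le (hx.trans hxy).le hxy.le) hden
    (erfDensity_pos x) (mul_pos hx (erfG_pos hx))

lemma continuousOn_erfRatio : ContinuousOn erfRatio (Set.Ioi 0) :=
  continuous_erfDensity.continuousOn.div (continuous_id.mul continuous_erfG).continuousOn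
    fun _ hx => (mul_pos hx (erfG_pos hx)).ne'

lemma tendsto_erfRatio_nhdsGT_zero : Tendsto erfRatio (𝓝[>] 0) atTop := by
  have hnum : Tendsto erfDensity (𝓝[>] 0) (𝓝 (erfDensity 0)) :=
    continuous_erfDensity.continuousAt.mono_left nhdsWithin_le_nhds
  have hden : Tendsto (fun x => x * erfG x) (𝓝[>] 0) (𝓝[>] 0) := by
    refine tendsto_nhdsWithin_iff.2 ⟨?_, ?_⟩
    · have hc : Continuous fun x => x * erfG x := continuous_id.mul continuous_erfG
      simpa using (hc.tendsto 0).mono_left nhdsWithin_le_nhds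
    · filter_upwards [self_mem_nhdsWithin] with x hx using mul_pos hx (erfG_pos hx)
  exact hnum.pos_mul_atTop (erfDensity_pos 0) hden.inv_tendsto_nhdsGT_zero

lemma tendsto_erfRatio_atTop : Tendsto erfRatio atTop (𝓝 0) := by
  have hbound : Tendsto (fun x : ℝ => erfDensity 0 / (x * erfG 1)) atTop (𝓝 0) :=
    tendsto_const_nhds.div_atTop (tendsto_id.atTop_mul_const (erfG_pos one_pos))
  refine squeeze_zero' ?_ ?_ hbound
  · filter_upwards [eventually_gt_atTop 0] with x hx using (erfRatio_pos hx).le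
  · filter_upwards [eventually_ge_atTop 1] with x hx
    have hx0 : 0 < x := one_pos.trans_le hx
    exact div_le_div₀ (erfDensity_pos 0).le
      (antitoneOn_erfDensity Set.self_mem_Ici hx0.le hx0.le) (mul_pos hx0 (erfG_pos one_pos))
      (mul_le_mul_of_nonneg_left (strictMono_erfG.monotone hx) hx0.le)

section Saddle

variable {ι : Type*} [Fintype ι] {C x₀ x : ℝ} {D w : ι → ℝ}

/-- The left side of the saddle-point equation `∑ᵢ wᵢ g(wᵢ x) Dᵢ / (x G(wᵢ x)) = 2 C`, with the
weights arranged so that each summand is a multiple of `erfRatio`. -/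
noncomputable def saddleRatio (D w : ι → ℝ) (x : ℝ) : ℝ :=
  ∑ i, D i * w i ^ 2 * erfRatio (w i * x)

lemma saddleRatio_eq_sum (hw : ∀ i, 0 < w i) (D : ι → ℝ) (x : ℝ) :
    saddleRatio D w x = ∑ i, w i * erfDensity (w i * x) * D i / (x * erfG (w i * x)) := by
  refine Finset.sum_congr rfl fun i _ => ?_
  rw [erfRatio, ← mul_div_assoc, ← mul_div_mul_left _ (x * _) (hw i).ne']
  ring_nf

lemma strictAntiOn_saddleRatio (hw : ∀ i, 0 < w i) (hD : ∀ i, 0 ≤ D i) (hDsum : 0 < ∑ i, D i) :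
    StrictAntiOn (saddleRatio D w) (Set.Ioi 0) := by
  intro x hx y hy hxy
  have hratio : ∀ i, erfRatio (w i * y) < erfRatio (w i * x) := fun i =>
    strictAntiOn_erfRatio (mul_pos (hw i) hx) (mul_pos (hw i) hy)
      (mul_lt_mul_of_pos_left hxy (hw i))
  obtain ⟨i₀, -, hi₀⟩ := Finset.exists_lt_of_sum_lt (by simpa using hDsum : ∑ _ : ι, (0 : ℝ) < _)
  refine Finset.sum_lt_sum (fun i _ => ?_) ⟨i₀, Finset.mem_univ _, ?_⟩
  · exact mul_le_mul_of_nonneg_left (hratio i).le (mul_nonneg (hD i) (sq_nonneg _))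
  · exact mul_lt_mul_of_pos_left (hratio i₀) (mul_pos hi₀ (pow_pos (hw i₀) 2))

lemma continuousOn_saddleRatio (hw : ∀ i, 0 < w i) (D : ι → ℝ) :
    ContinuousOn (saddleRatio D w) (Set.Ioi 0) :=
  continuousOn_finsetSum _ fun i _ => continuousOn_const.mul <|
    continuousOn_erfRatio.comp (by fun_prop) fun _ hx => mul_pos (hw i) hx

lemma tendsto_saddleRatio_nhdsGT_zero (hw : ∀ i, 0 < w i) (hD : ∀ i, 0 ≤ D i)
    (hDsum : 0 < ∑ i, D i) : Tendsto (saddleRatio D w) (𝓝[>] 0) atTop := by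
  obtain ⟨i₀, -, hi₀⟩ := Finset.exists_lt_of_sum_lt (by simpa using hDsum : ∑ _ : ι, (0 : ℝ) < _)
  have hscale : Tendsto (w i₀ * ·) (𝓝[>] 0) (𝓝[>] 0) :=
    tendsto_iff_comap.2 (comap_mulLeft_nhdsGT_zero (hw i₀)).ge
  refine tendsto_atTop_mono' _ ?_ ((tendsto_erfRatio_nhdsGT_zero.comp hscale).const_mul_atTop
    (mul_pos hi₀ (pow_pos (hw i₀) 2)))
  filter_upwards [self_mem_nhdsWithin] with x hx
  exact Finset.single_le_sum (f := fun i => D i * w i ^ 2 * erfRatio (w i * x)) (fun i _ =>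
    mul_nonneg (mul_nonneg (hD i) (sq_nonneg _)) (erfRatio_pos (mul_pos (hw i) hx)).le)
    (Finset.mem_univ i₀)

lemma tendsto_saddleRatio_atTop (hw : ∀ i, 0 < w i) (D : ι → ℝ) :
    Tendsto (saddleRatio D w) atTop (𝓝 0) := by
  have hterm : ∀ i, Tendsto (fun x => D i * w i ^ 2 * erfRatio (w i * x)) atTop (𝓝 0) := fun i => by
    simpa using (tendsto_erfRatio_atTop.comp (tendsto_id.const_mul_atTop (hw i))).const_mul
      (D i * w i ^ 2)
  simpa only [Finset.sum_const_zero] using! tendsto_finsetSum Finset.univ fun i _ => hterm i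

lemma exists_saddleRatio_eq (hw : ∀ i, 0 < w i) (hD : ∀ i, 0 ≤ D i) (hDsum : 0 < ∑ i, D i)
    {c : ℝ} (hc : 0 < c) : ∃ x₀, 0 < x₀ ∧ saddleRatio D w x₀ = c := by
  obtain ⟨a, ha, ha0⟩ := (((tendsto_saddleRatio_nhdsGT_zero hw hD hDsum).eventually_ge_atTop c).and
    self_mem_nhdsWithin).exists
  obtain ⟨b, hb, hb0⟩ := (((tendsto_saddleRatio_atTop hw D).eventually_le_const hc).and
    (eventually_gt_atTop 0)).exists
  exact isPreconnected_Ioi.intermediate_value hb0 ha0 (continuousOn_saddleRatio hw D) ⟨hb, ha⟩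

/-- The exponent `C x² - ∑ᵢ Dᵢ log G(wᵢ x)`, whose minimum over `x > 0` is the rate of decay. -/
noncomputable def erfExponent (C : ℝ) (D w : ι → ℝ) (x : ℝ) : ℝ :=
  C * x ^ 2 - ∑ i, D i * Real.log (erfG (w i * x))

lemma hasDerivAt_erfExponent (hw : ∀ i, 0 < w i) (C : ℝ) (D : ι → ℝ) (hx : 0 < x) :
    HasDerivAt (erfExponent C D w) (x * (2 * C - saddleRatio D w x)) x := by
  have hlog : ∀ i, HasDerivAt (fun x => D i * Real.log (erfG (w i * x)))
      (x * (D i * w i ^ 2 * erfRatio (w i * x))) x := fun i => by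
    have hwx := mul_pos (hw i) hx
    refine ((((hasDerivAt_erfG (w i * x)).comp x ((hasDerivAt_id x).const_mul (w i))).log
      (erfG_pos hwx).ne').const_mul (D i)).congr_deriv ?_
    have := (erfG_pos hwx).ne'
    have := (hw i).ne'
    simp only [erfRatio, Function.comp_apply]
    field_simp
  have hsq : HasDerivAt (fun x => C * x ^ 2) (x * (2 * C)) x := by
    refine ((hasDerivAt_pow 2 x).const_mul C).congr_deriv ?_
    ring
  refine (hsq.sub (HasDerivAt.fun_sum fun i _ => hlog i)).congr_deriv ?_
  rw [saddleRatio, mul_sub, Finset.mul_sum]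

lemma isMinOn_erfExponent (hw : ∀ i, 0 < w i) (hD : ∀ i, 0 ≤ D i) (hDsum : 0 < ∑ i, D i)
    (hx₀ : 0 < x₀) (h : saddleRatio D w x₀ = 2 * C) :
    IsMinOn (erfExponent C D w) (Set.Ioi 0) x₀ := by
  have hderiv := fun {y : ℝ} (hy : 0 < y) => hasDerivAt_erfExponent hw C D hy
  have hanti := (strictAntiOn_saddleRatio hw hD hDsum).antitoneOn
  refine isMinOn_Ioi_of_deriv (hderiv hx₀).continuousAt
    (fun y hy => (hderiv hy.1).differentiableAt.differentiableWithinAt)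
    (fun y hy => (hderiv (hx₀.trans hy)).differentiableAt.differentiableWithinAt)
    (fun y hy => ?_) fun y hy => ?_
  · rw [(hderiv hy.1).deriv, ← h]
    exact mul_nonpos_of_nonneg_of_nonpos hy.1.le (sub_nonpos.2 (hanti hy.1 hx₀ hy.2.le))
  · have hy0 : 0 < y := hx₀.trans hy
    rw [(hderiv hy0).deriv, ← h]
    exact mul_nonneg hy0.le (sub_nonneg.2 (hanti hx₀ hy0 (le_of_lt hy)))

end Saddle

/-! ### Laplace's method -/

section Laplace

variable {ι κ X : Type*} [Fintype ι] {u : ι → X → ℝ} {a b : ι → ℝ} {ψ : ℝ}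

lemma exp_neg_sum_mul_le {v : ι → ℝ} {r : ℝ} (hv : ∀ i, 0 ≤ v i) (hr : 1 ≤ r)
    (hab : ∀ i, r * a i ≤ b i) (hψ : ψ ≤ ∑ i, a i * v i) :
    Real.exp (-∑ i, b i * v i) ≤ Real.exp (-((r - 1) * ψ)) * Real.exp (-∑ i, a i * v i) := by
  have hsum : r * ∑ i, a i * v i ≤ ∑ i, b i * v i := by
    rw [Finset.mul_sum]
    refine Finset.sum_le_sum fun i _ => ?_
    rw [← mul_assoc]
    exact mul_le_mul_of_nonneg_right (hab i) (hv i)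
  rw [← Real.exp_add, Real.exp_le_exp]
  linarith [mul_le_mul_of_nonneg_left hψ (sub_nonneg.2 hr)]

lemma subset_setOf_exp_neg_sum_mul_le {s : Set X} {v : ι → ℝ} (hb : ∀ i, 0 ≤ b i)
    (hs : ∀ x ∈ s, ∀ i, u i x ≤ v i) :
    s ⊆ {x | Real.exp (-∑ i, b i * v i) ≤ Real.exp (-∑ i, b i * u i x)} := fun x hx =>
  Real.exp_le_exp.2 <| neg_le_neg <| Finset.sum_le_sum fun i _ =>
    mul_le_mul_of_nonneg_left (hs x hx i) (hb i)

variable [MeasurableSpace X] {μ : Measure X}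

/-- The Laplace integral `∫ exp(-∑ᵢ bᵢ uᵢ) dμ`, whose phase is a combination of fixed functions
`uᵢ` with large coefficients `bᵢ`. -/
noncomputable def laplaceIntegral (μ : Measure X) (u : ι → X → ℝ) (b : ι → ℝ) : ℝ :=
  ∫ x, Real.exp (-∑ i, b i * u i x) ∂μ

lemma ae_exp_neg_sum_mul_le {r : ℝ} (hu : ∀ i, 0 ≤ᵐ[μ] u i) (hr : 1 ≤ r)
    (hab : ∀ i, r * a i ≤ b i) (hψ : ∀ᵐ x ∂μ, ψ ≤ ∑ i, a i * u i x) :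
    ∀ᵐ x ∂μ, Real.exp (-∑ i, b i * u i x) ≤
      Real.exp (-((r - 1) * ψ)) * Real.exp (-∑ i, a i * u i x) := by
  filter_upwards [eventually_all.2 hu, hψ] with x hux hψx
  exact exp_neg_sum_mul_le hux hr hab hψx

lemma integrable_exp_neg_sum_mul {r : ℝ} (hu : ∀ i, 0 ≤ᵐ[μ] u i) (hum : ∀ i, AEMeasurable (u i) μ)
    (hr : 1 ≤ r) (hab : ∀ i, r * a i ≤ b i) (hψ : ∀ᵐ x ∂μ, ψ ≤ ∑ i, a i * u i x)
    (hint : Integrable (fun x => Real.exp (-∑ i, a i * u i x)) μ) :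
    Integrable (fun x => Real.exp (-∑ i, b i * u i x)) μ := by
  refine (hint.const_mul (Real.exp (-((r - 1) * ψ)))).mono'
    (AEMeasurable.aestronglyMeasurable (by fun_prop)) ?_
  filter_upwards [ae_exp_neg_sum_mul_le hu hr hab hψ] with x hx
  rwa [Real.norm_of_nonneg (Real.exp_pos _).le]

lemma laplaceIntegral_le {r : ℝ} (hu : ∀ i, 0 ≤ᵐ[μ] u i) (hr : 1 ≤ r)
    (hab : ∀ i, r * a i ≤ b i) (hψ : ∀ᵐ x ∂μ, ψ ≤ ∑ i, a i * u i x)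
    (hint : Integrable (fun x => Real.exp (-∑ i, a i * u i x)) μ) :
    laplaceIntegral μ u b ≤ Real.exp (-((r - 1) * ψ)) * laplaceIntegral μ u a := by
  rw [laplaceIntegral, laplaceIntegral, ← integral_const_mul]
  exact integral_mono_of_nonneg (ae_of_all _ fun x => (Real.exp_pos _).le) (hint.const_mul _)
    (ae_exp_neg_sum_mul_le hu hr hab hψ)

lemma laplaceIntegral_pos [NeZero μ]
    (hint : Integrable (fun x => Real.exp (-∑ i, b i * u i x)) μ) : 0 < laplaceIntegral μ u b :=
  integral_exp_pos hint

lemma measure_lt_top_of_integrable_exp_neg_sum_mul {s : Set X} {v : ι → ℝ} (hb : ∀ i, 0 ≤ b i)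
    (hs : ∀ x ∈ s, ∀ i, u i x ≤ v i)
    (hint : Integrable (fun x => Real.exp (-∑ i, b i * u i x)) μ) : μ s < ⊤ :=
  (measure_mono (subset_setOf_exp_neg_sum_mul_le hb hs)).trans_lt
    (hint.measure_ge_lt_top (Real.exp_pos _))

lemma exp_mul_measureReal_le_laplaceIntegral {s : Set X} {v : ι → ℝ} (hb : ∀ i, 0 ≤ b i)
    (hs : ∀ x ∈ s, ∀ i, u i x ≤ v i)
    (hint : Integrable (fun x => Real.exp (-∑ i, b i * u i x)) μ) :
    Real.exp (-∑ i, b i * v i) * μ.real s ≤ laplaceIntegral μ u b := by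
  refine le_trans ?_ (mul_meas_ge_le_integral_of_nonneg (ae_of_all _ fun x => (Real.exp_pos _).le)
    hint (Real.exp (-∑ i, b i * v i)))
  exact mul_le_mul_of_nonneg_left (measureReal_mono (subset_setOf_exp_neg_sum_mul_le hb hs)
    (hint.measure_ge_lt_top (Real.exp_pos _)).ne) (Real.exp_pos _).le

variable {l : Filter κ} {N : κ → ℝ}

lemma eventually_mul_mul_le_of_tendsto_div {c : κ → ℝ} {α r : ℝ} (hα : 0 ≤ α) (hr : r < 1)
    (hN : Tendsto N l atTop) (hc : ∀ᶠ j in l, 0 ≤ c j)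
    (hlim : Tendsto (fun j => c j / N j) l (𝓝 α)) : ∀ᶠ j in l, r * N j * α ≤ c j := by
  rcases hα.eq_or_lt with rfl | hα
  · simpa using hc
  · filter_upwards [hlim.eventually_const_lt (mul_lt_of_lt_one_left hα hr),
      hN.eventually_gt_atTop 0] with j hj hNj
    rw [lt_div_iff₀ hNj] at hj
    linarith

lemma eventually_forall_mul_mul_le {ι : Type*} [Finite ι] {a : ι → ℝ} {b : κ → ι → ℝ} {r : ℝ}
    (ha : ∀ i, 0 ≤ a i) (hr : r < 1) (hN : Tendsto N l atTop) (hb : ∀ᶠ j in l, ∀ i, 0 ≤ b j i)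
    (hlim : ∀ i, Tendsto (fun j => b j i / N j) l (𝓝 (a i))) :
    ∀ᶠ j in l, ∀ i, r * N j * a i ≤ b j i :=
  eventually_all.2 fun i => eventually_mul_mul_le_of_tendsto_div (ha i) hr hN
    (hb.mono fun _ hj => hj i) (hlim i)

lemma eventually_lt_neg_log_laplaceIntegral_div [NeZero μ] {b : κ → ι → ℝ} {y : ℝ}
    (hu : ∀ i, 0 ≤ᵐ[μ] u i) (hum : ∀ i, AEMeasurable (u i) μ)
    (hint : Integrable (fun x => Real.exp (-∑ i, a i * u i x)) μ)
    (hψ : ∀ᵐ x ∂μ, ψ ≤ ∑ i, a i * u i x) (ha : ∀ i, 0 ≤ a i) (hN : Tendsto N l atTop)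
    (hb : ∀ᶠ j in l, ∀ i, 0 ≤ b j i) (hlim : ∀ i, Tendsto (fun j => b j i / N j) l (𝓝 (a i)))
    (hy : y < ψ) : ∀ᶠ j in l, y < -(Real.log (laplaceIntegral μ u (b j)) / N j) := by
  obtain ⟨r, hyr, hr0, hr1⟩ : ∃ r : ℝ, y < r * ψ ∧ 0 < r ∧ r < 1 := by
    have hc : Tendsto (fun r : ℝ => r * ψ) (𝓝[<] 1) (𝓝 ψ) := by
      simpa using (((continuous_mul_const ψ).tendsto 1).mono_left nhdsWithin_le_nhds :
        Tendsto (fun r : ℝ => r * ψ) (𝓝[<] 1) _)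
    exact ((hc.eventually_const_lt hy).and (Ioo_mem_nhdsLT one_pos)).exists
  have hbound : Tendsto (fun j => (r - (N j)⁻¹) * ψ - Real.log (laplaceIntegral μ u a) / N j) l
      (𝓝 (r * ψ)) := by
    simpa using ((hN.inv_tendsto_atTop.const_sub r).mul_const ψ).sub (hN.const_div_atTop _)
  filter_upwards [hbound.eventually_const_lt hyr, hN.eventually_gt_atTop 0,
    eventually_forall_mul_mul_le ha hr1 hN hb hlim,
    (hN.const_mul_atTop hr0).eventually_ge_atTop 1] with j hj hNj hab hrN
  have hlog := Real.log_le_log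
    (laplaceIntegral_pos (integrable_exp_neg_sum_mul hu hum hrN hab hψ hint))
    (laplaceIntegral_le hu hrN hab hψ hint)
  rw [Real.log_mul (Real.exp_pos _).ne' (laplaceIntegral_pos hint).ne', Real.log_exp] at hlog
  calc y < (r - (N j)⁻¹) * ψ - Real.log (laplaceIntegral μ u a) / N j := hj
    _ = -((-((r * N j - 1) * ψ) + Real.log (laplaceIntegral μ u a)) / N j) := by field_simp; ring
    _ ≤ -(Real.log (laplaceIntegral μ u (b j)) / N j) := by gcongr

variable [TopologicalSpace X] {x₀ : X}

lemma eventually_neg_log_laplaceIntegral_div_lt {b : κ → ι → ℝ} {y : ℝ}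
    (hx₀ : x₀ ∈ μ.support) (huc : ∀ i, ContinuousAt (u i) x₀) (hN : Tendsto N l atTop)
    (hint : ∀ᶠ j in l, Integrable (fun x => Real.exp (-∑ i, b j i * u i x)) μ)
    (hb : ∀ᶠ j in l, ∀ i, 0 ≤ b j i) (hlim : ∀ i, Tendsto (fun j => b j i / N j) l (𝓝 (a i)))
    (hy : ∑ i, a i * u i x₀ < y) :
    ∀ᶠ j in l, -(Real.log (laplaceIntegral μ u (b j)) / N j) < y := by
  obtain ⟨ε, hεy, hε⟩ : ∃ ε : ℝ, ∑ i, a i * (u i x₀ + ε) < y ∧ 0 < ε := by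
    have hc : Tendsto (fun ε : ℝ => ∑ i, a i * (u i x₀ + ε)) (𝓝[>] 0)
        (𝓝 (∑ i, a i * (u i x₀ + 0))) :=
      ((by fun_prop : Continuous fun ε : ℝ => ∑ i, a i * (u i x₀ + ε)).tendsto 0).mono_left
        nhdsWithin_le_nhds
    simp only [add_zero] at hc
    exact ((hc.eventually_lt_const hy).and self_mem_nhdsWithin).exists
  set U : Set X := {x | ∀ i, u i x ≤ u i x₀ + ε}
  have hU : 0 < μ U := (Measure.mem_support_iff_forall x₀).1 hx₀ U <| eventually_all.2 fun i =>
    (huc i).eventually_le_const (lt_add_of_pos_right _ hε)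
  have hbound : Tendsto (fun j => ∑ i, b j i / N j * (u i x₀ + ε) - Real.log (μ.real U) / N j) l
      (𝓝 (∑ i, a i * (u i x₀ + ε))) := by
    simpa using (tendsto_finsetSum Finset.univ fun i _ => (hlim i).mul_const (u i x₀ + ε)).sub
      (hN.const_div_atTop (Real.log (μ.real U)))
  filter_upwards [hbound.eventually_lt_const hεy, hN.eventually_gt_atTop 0, hb, hint]
    with j hj hNj hbj hintj
  have hUtop := measure_lt_top_of_integrable_exp_neg_sum_mul hbj (fun x (hx : x ∈ U) => hx) hintj
  have hU0 : 0 < μ.real U := ENNReal.toReal_pos hU.ne' hUtop.ne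
  have hlog := Real.log_le_log (mul_pos (Real.exp_pos _) hU0)
    (exp_mul_measureReal_le_laplaceIntegral hbj (fun x (hx : x ∈ U) => hx) hintj)
  rw [Real.log_mul (Real.exp_pos _).ne' hU0.ne', Real.log_exp] at hlog
  calc -(Real.log (laplaceIntegral μ u (b j)) / N j)
      ≤ -((-∑ i, b j i * (u i x₀ + ε) + Real.log (μ.real U)) / N j) := by gcongr
    _ = ∑ i, b j i / N j * (u i x₀ + ε) - Real.log (μ.real U) / N j := by
        simp only [div_mul_eq_mul_div, ← Finset.sum_div]
        ring
    _ < y := hj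

theorem tendsto_neg_log_laplaceIntegral_div {b : κ → ι → ℝ}
    (hu : ∀ i, 0 ≤ᵐ[μ] u i) (hum : ∀ i, AEMeasurable (u i) μ)
    (huc : ∀ i, ContinuousAt (u i) x₀) (hx₀ : x₀ ∈ μ.support)
    (hint : Integrable (fun x => Real.exp (-∑ i, a i * u i x)) μ)
    (hmin : ∀ᵐ x ∂μ, ∑ i, a i * u i x₀ ≤ ∑ i, a i * u i x) (ha : ∀ i, 0 ≤ a i)
    (hN : Tendsto N l atTop) (hb : ∀ᶠ j in l, ∀ i, 0 ≤ b j i)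
    (hlim : ∀ i, Tendsto (fun j => b j i / N j) l (𝓝 (a i))) :
    Tendsto (fun j => -(Real.log (laplaceIntegral μ u (b j)) / N j)) l
      (𝓝 (∑ i, a i * u i x₀)) := by
  have hμ : NeZero μ := ⟨fun h0 => by simp [h0] at hx₀⟩
  refine tendsto_order.2 ⟨fun y hy =>
    eventually_lt_neg_log_laplaceIntegral_div hu hum hint hmin ha hN hb hlim hy, fun y hy =>
    eventually_neg_log_laplaceIntegral_div_lt hx₀ huc hN ?_ hb hlim hy⟩
  filter_upwards [eventually_forall_mul_mul_le ha one_half_lt_one hN hb hlim,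
    (hN.const_mul_atTop one_half_pos).eventually_ge_atTop 1] with j hab hrN
  exact integrable_exp_neg_sum_mul hu hum hrN hab hmin hint

end Laplace

/-! ### Growth rate of the Gaussian–erf integral -/

section ErfIntegral

variable {ι κ : Type*} {C x₀ : ℝ} {D w : ι → ℝ}

/-- The functions of which `erfExponent C D w` is a linear combination: `x²` at `none`, with
coefficient `C`, and the nonnegative function `-log G(wᵢ x)` at `some i`, with coefficient `Dᵢ`. -/
noncomputable def erfPhase (w : ι → ℝ) : Option ι → ℝ → ℝ
  | none, x => x ^ 2
  | some i, x => -Real.log (erfG (w i * x))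

lemma erfPhase_nonneg (hw : ∀ i, 0 < w i) {x : ℝ} (hx : 0 < x) :
    ∀ i : Option ι, 0 ≤ erfPhase w i x
  | none => sq_nonneg x
  | some i => neg_nonneg.2 (log_erfG_nonpos (mul_pos (hw i) hx).le)

lemma measurable_erfPhase (w : ι → ℝ) : ∀ i : Option ι, Measurable (erfPhase w i)
  | none => measurable_id.pow_const 2
  | some i => (Real.measurable_log.comp
      (continuous_erfG.measurable.comp (measurable_const_mul (w i)))).neg

lemma continuousAt_erfPhase (hw : ∀ i, 0 < w i) {x : ℝ} (hx : 0 < x) :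
    ∀ i : Option ι, ContinuousAt (erfPhase w i) x
  | none => (continuous_pow 2).continuousAt
  | some i => ((continuous_erfG.comp (continuous_const_mul (w i))).continuousAt.log
      (erfG_pos (mul_pos (hw i) hx)).ne').neg

variable [Fintype ι]

lemma erfExponent_eq_sum (C : ℝ) (D w : ι → ℝ) (x : ℝ) :
    erfExponent C D w x = ∑ i : Option ι, i.elim C D * erfPhase w i x := by
  simp [erfExponent, erfPhase, sub_eq_add_neg]

lemma integrableOn_exp_neg_erfExponent (hw : ∀ i, 0 < w i) (hC : 0 < C) (hD : ∀ i, 0 ≤ D i) :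
    IntegrableOn (fun x => Real.exp (-erfExponent C D w x)) (Set.Ioi 0) := by
  refine (integrable_exp_neg_mul_sq hC).integrableOn.mono' ?_ ?_
  · have := measurable_erfPhase w
    simp only [erfExponent_eq_sum]
    exact (by fun_prop : Measurable _).aestronglyMeasurable
  · filter_upwards [ae_restrict_mem measurableSet_Ioi] with x hx
    have hsum : ∑ i, D i * Real.log (erfG (w i * x)) ≤ 0 := Finset.sum_nonpos fun i _ =>
      mul_nonpos_of_nonneg_of_nonpos (hD i) (log_erfG_nonpos (mul_pos (hw i) hx).le)
    rw [Real.norm_of_nonneg (Real.exp_pos _).le, Real.exp_le_exp, erfExponent]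
    linarith

variable {l : Filter κ} {N A : κ → ℝ} {d : κ → ι → ℝ}

lemma tendsto_log_div_of_tendsto_div (hC : C ≠ 0) (hN : Tendsto N l atTop)
    (hA : Tendsto (fun j => A j / N j) l (𝓝 C)) :
    Tendsto (fun j => Real.log (A j) / N j) l (𝓝 0) := by
  have hlogN : Tendsto (fun j => Real.log (N j) / N j) l (𝓝 0) :=
    Real.isLittleO_log_id_atTop.tendsto_div_nhds_zero.comp hN
  have hsum : Tendsto (fun j => Real.log (A j / N j) / N j + Real.log (N j) / N j) l (𝓝 0) := by
    simpa using ((hA.log hC).div_atTop hN).add hlogN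
  refine hsum.congr' ?_
  filter_upwards [hA.eventually_ne hC, hN.eventually_gt_atTop 0] with j hj hNj
  rw [← add_div, ← Real.log_mul hj hNj.ne', div_mul_cancel₀ _ hNj.ne']

lemma eventually_pos_of_tendsto_div (hC : 0 < C) (hN : Tendsto N l atTop)
    (hA : Tendsto (fun j => A j / N j) l (𝓝 C)) : ∀ᶠ j in l, 0 < A j := by
  filter_upwards [hA.eventually_const_lt hC, hN.eventually_gt_atTop 0] with j hj hNj
  exact (div_pos_iff_of_pos_right hNj).1 hj

lemma tendsto_log_sqrt_div_pi_div (hC : 0 < C) (hN : Tendsto N l atTop)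
    (hA : Tendsto (fun j => A j / N j) l (𝓝 C)) :
    Tendsto (fun j => Real.log √(A j / Real.pi) / N j) l (𝓝 0) := by
  have hApi : Tendsto (fun j => A j / Real.pi / N j) l (𝓝 (C / Real.pi)) := by
    simpa only [div_right_comm] using hA.div_const Real.pi
  have hlog := (tendsto_log_div_of_tendsto_div (by positivity) hN hApi).div_const 2
  rw [zero_div] at hlog
  refine hlog.congr' ?_
  filter_upwards [eventually_pos_of_tendsto_div hC hN hA] with j hj
  rw [Real.log_sqrt (by positivity), div_right_comm]

lemma tendsto_neg_log_integral_exp_neg_erfExponent (hw : ∀ i, 0 < w i) (hC : 0 < C)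
    (hD : ∀ i, 0 ≤ D i) (hx₀ : 0 < x₀) (hmin : IsMinOn (erfExponent C D w) (Set.Ioi 0) x₀)
    (hN : Tendsto N l atTop) (hd : ∀ j i, 0 ≤ d j i)
    (hA : Tendsto (fun j => A j / N j) l (𝓝 C))
    (hlim : ∀ i, Tendsto (fun j => d j i / N j) l (𝓝 (D i))) :
    Tendsto (fun j => -(Real.log
      (∫ x in Set.Ioi 0, Real.exp (-erfExponent (A j) (d j) w x)) / N j)) l
      (𝓝 (erfExponent C D w x₀)) := by
  have hA0 : ∀ᶠ j in l, 0 ≤ A j := (eventually_pos_of_tendsto_div hC hN hA).mono fun _ => le_of_lt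
  have hint := integrableOn_exp_neg_erfExponent hw hC hD
  have hmin' : ∀ᵐ x ∂volume.restrict (Set.Ioi 0), erfExponent C D w x₀ ≤ erfExponent C D w x :=
    ae_restrict_of_forall_mem measurableSet_Ioi hmin
  simp only [erfExponent_eq_sum, IntegrableOn] at hint hmin' ⊢
  refine tendsto_neg_log_laplaceIntegral_div
    (fun i => ae_restrict_of_forall_mem measurableSet_Ioi fun x hx => erfPhase_nonneg hw hx i)
    (fun i => (measurable_erfPhase w i).aemeasurable) (continuousAt_erfPhase hw hx₀)
    (Measure.interior_inter_support ⟨by simpa using hx₀, by simp [Measure.support_eq_univ]⟩)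
    hint hmin' (Option.forall.2 ⟨hC.le, hD⟩) hN ?_ (Option.forall.2 ⟨hA, hlim⟩)
  filter_upwards [hA0] with j hj using Option.forall.2 ⟨hj, hd j⟩

/-- The Gaussian–erf integral `√(A/π) ∫₀^∞ exp(-A x²) ∏ᵢ G(wᵢ x)^dᵢ dx`, the external angle of a
face, with the product written as an exponential. -/
noncomputable def gaussianErfIntegral (A : ℝ) (d w : ι → ℝ) : ℝ :=
  √(A / Real.pi) * ∫ x in Set.Ioi 0, Real.exp (-erfExponent A d w x)

theorem tendsto_neg_log_gaussianErfIntegral (hw : ∀ i, 0 < w i) (hC : 0 < C)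
    (hD : ∀ i, 0 ≤ D i) (hx₀ : 0 < x₀) (hmin : IsMinOn (erfExponent C D w) (Set.Ioi 0) x₀)
    (hN : Tendsto N l atTop) (hd : ∀ j i, 0 ≤ d j i)
    (hA : Tendsto (fun j => A j / N j) l (𝓝 C))
    (hlim : ∀ i, Tendsto (fun j => d j i / N j) l (𝓝 (D i))) :
    Tendsto (fun j => -(Real.log (gaussianErfIntegral (A j) (d j) w) / N j)) l
      (𝓝 (erfExponent C D w x₀)) := by
  have hsum := (tendsto_log_sqrt_div_pi_div hC hN hA).neg.add
    (tendsto_neg_log_integral_exp_neg_erfExponent hw hC hD hx₀ hmin hN hd hA hlim)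
  rw [neg_zero, zero_add] at hsum
  refine hsum.congr' ?_
  filter_upwards [eventually_pos_of_tendsto_div hC hN hA] with j hj
  have hI : 0 < ∫ x in Set.Ioi 0, Real.exp (-erfExponent (A j) (d j) w x) :=
    have : NeZero (volume.restrict (Set.Ioi (0 : ℝ))) := ⟨by simp⟩
    integral_exp_pos (integrableOn_exp_neg_erfExponent hw hj (hd j))
  rw [gaussianErfIntegral, Real.log_mul (by positivity) hI.ne']
  ring

end ErfIntegral

/-! ### Spherical fractions as Gaussian ratios -/

section Polar

lemma setIntegral_cone_fun_norm {E : Type*} [NormedAddCommGroup E] [NormedSpace ℝ E]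
    [FiniteDimensional ℝ E] [Nontrivial E] [MeasurableSpace E] [BorelSpace E] (μ : Measure E)
    [μ.IsAddHaarMeasure] {c : Set E} (hc : MeasurableSet c)
    (hcone : ∀ r : ℝ, 0 < r → ∀ x ∈ c, r • x ∈ c) (f : ℝ → ℝ) :
    ∫ x in c, f ‖x‖ ∂μ = μ.toSphere.real {u | (u : E) ∈ c} *
      ∫ r : Set.Ioi (0 : ℝ), f r ∂(Measure.volumeIoiPow (Module.finrank ℝ E - 1)) := by
  set S : Set (Metric.sphere (0 : E) 1) := {u | (u : E) ∈ c}
  have hS : MeasurableSet S := measurable_subtype_coe hc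
  have hnormalize : ∀ x : ({0}ᶜ : Set E), ‖(x : E)‖⁻¹ • (x : E) ∈ c ↔ (x : E) ∈ c := fun x => by
    have hx : 0 < ‖(x : E)‖ := norm_pos_iff.2 x.2
    refine ⟨fun h => ?_, hcone _ (inv_pos.2 hx) _⟩
    simpa [smul_smul, hx.ne'] using hcone _ hx _ h
  calc ∫ x in c, f ‖x‖ ∂μ
      = ∫ x : ({0}ᶜ : Set E), c.indicator (fun x => f ‖x‖) x ∂(μ.comap (↑)) := by
        rw [integral_subtype_comap (measurableSet_singleton _).compl
          (c.indicator fun x => f ‖x‖), restrict_compl_singleton, integral_indicator hc]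
    _ = ∫ p, S.indicator 1 p.1 * f p.2
          ∂μ.toSphere.prod (.volumeIoiPow (Module.finrank ℝ E - 1)) := by
        rw [← μ.measurePreserving_homeomorphUnitSphereProd.integral_comp
          (Homeomorph.measurableEmbedding _)]
        refine integral_congr_ae (ae_of_all _ fun x => ?_)
        by_cases hx : (x : E) ∈ c <;> simp [S, hx, hnormalize x]
    _ = _ := by
        rw [integral_prod_mul (S.indicator (1 : Metric.sphere (0 : E) 1 → ℝ))
          (fun r : Set.Ioi (0 : ℝ) => f r), integral_indicator_one hS]

variable {V : Type*} [NormedAddCommGroup V] [InnerProductSpace ℝ V] [FiniteDimensional ℝ V]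
  [MeasurableSpace V] [BorelSpace V]

lemma integral_exp_neg_norm_sq :
    ∫ v : V, Real.exp (-‖v‖ ^ 2) = √Real.pi ^ Module.finrank ℝ V := by
  have h := GaussianFourier.integral_rexp_neg_mul_sq_norm (V := V) one_pos
  simp only [neg_mul, one_mul, div_one] at h
  rw [h, Real.sqrt_eq_rpow, ← Real.rpow_natCast, ← Real.rpow_mul Real.pi_pos.le]
  ring_nf

lemma integrable_exp_neg_norm_sq : Integrable fun v : V => Real.exp (-‖v‖ ^ 2) := by
  refine Integrable.of_integral_ne_zero ?_
  rw [integral_exp_neg_norm_sq]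
  positivity

lemma toSphere_real_div_eq_gaussian [Nontrivial V] {c : Set V} (hc : MeasurableSet c)
    (hcone : ∀ r : ℝ, 0 < r → ∀ x ∈ c, r • x ∈ c) :
    (volume : Measure V).toSphere.real {u | (u : V) ∈ c} /
        (volume : Measure V).toSphere.real Set.univ =
      (∫ x in c, Real.exp (-‖x‖ ^ 2)) / ∫ x : V, Real.exp (-‖x‖ ^ 2) := by
  have hpart := setIntegral_cone_fun_norm volume hc hcone fun r => Real.exp (-r ^ 2)
  have htotal := setIntegral_cone_fun_norm (volume : Measure V) MeasurableSet.univ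
    (fun _ _ _ _ => Set.mem_univ _) fun r => Real.exp (-r ^ 2)
  have hpos : 0 < ∫ x : V, Real.exp (-‖x‖ ^ 2) := by
    rw [integral_exp_neg_norm_sq]
    positivity
  simp only [setIntegral_univ, Set.mem_univ, Set.ofPred_true] at htotal
  rw [htotal] at hpos
  rw [hpart, htotal, mul_div_mul_right _ _ (right_ne_zero_of_mul hpos.ne')]

lemma subspaceSphereMeasure_image_div_eq_gaussian [Nontrivial V] {n : ℕ} {c : Set V}
    (hc : MeasurableSet c) (hcone : ∀ r : ℝ, 0 < r → ∀ x ∈ c, r • x ∈ c)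
    (T : V →ₗᵢ[ℝ] EuclideanSpace ℝ (Fin n)) {U : Submodule ℝ (EuclideanSpace ℝ (Fin n))}
    (hU : LinearMap.range T.toLinearMap = U) :
    (subspaceSphereMeasure U).real {u | ((u : U) : EuclideanSpace ℝ (Fin n)) ∈ T '' c} /
        (subspaceSphereMeasure U).real Set.univ =
      (∫ z in c, Real.exp (-‖z‖ ^ 2)) / ∫ z : V, Real.exp (-‖z‖ ^ 2) := by
  subst hU
  set e := T.equivRange
  have : Nontrivial (LinearMap.range T.toLinearMap) := e.injective.nontrivial
  set c' : Set (LinearMap.range T.toLinearMap) := {u | (u : EuclideanSpace ℝ (Fin n)) ∈ T '' c}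
  have hpre : e ⁻¹' c' = c := Set.ext fun x => T.injective.mem_set_image
  have hc' : MeasurableSet c' := by
    have h : c' = e.symm ⁻¹' c := by
      rw [← hpre, ← Set.preimage_comp, e.self_comp_symm, Set.preimage_id]
    exact h ▸ e.symm.continuous.measurable hc
  have hcone' : ∀ r : ℝ, 0 < r → ∀ x ∈ c', r • x ∈ c' := by
    rintro r hr _ ⟨x, hx, hTx⟩
    exact ⟨r • x, hcone r hr x hx, by simp [hTx]⟩
  have hpart := e.measurePreserving.setIntegral_preimage_emb e.toHomeomorph.measurableEmbedding
    (fun u => Real.exp (-‖u‖ ^ 2)) c'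
  have htotal := e.measurePreserving.integral_comp e.toHomeomorph.measurableEmbedding
    fun u => Real.exp (-‖u‖ ^ 2)
  simp only [e.norm_map, hpre] at hpart htotal
  rw [hpart, htotal, ← toSphere_real_div_eq_gaussian hc' hcone']
  rfl

lemma sphereFraction_image_eq_gaussian [Nontrivial V] {n : ℕ} {c : Set V} (hc : MeasurableSet c)
    (hcone : ∀ r : ℝ, 0 < r → ∀ x ∈ c, r • x ∈ c) (hspan : Submodule.span ℝ c = ⊤)
    (T : V →ₗᵢ[ℝ] EuclideanSpace ℝ (Fin n)) :
    sphereFraction (T '' c) =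
      (∫ z in c, Real.exp (-‖z‖ ^ 2)) / ∫ z : V, Real.exp (-‖z‖ ^ 2) :=
  subspaceSphereMeasure_image_div_eq_gaussian hc hcone T <| by
    rw [LinearMap.range_eq_map, ← hspan, Submodule.map_span]
    rfl

end Polar

/-! ### The Gaussian measure of a wedge -/

section Wedge

variable {ι : Type*}

/-- The wedge `{(a, y) : 0 ≤ a, |yₖ| ≤ vₖ a}`, the model for the normal cones of the
cross-polytope. -/
def erfWedge (v : ι → ℝ) : Set (WithLp 2 (ℝ × EuclideanSpace ℝ ι)) :=
  {z | 0 ≤ z.fst ∧ ∀ k, |z.snd k| ≤ v k * z.fst}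

lemma smul_mem_erfWedge {v : ι → ℝ} {r : ℝ} (hr : 0 < r) {z : WithLp 2 (ℝ × EuclideanSpace ℝ ι)}
    (hz : z ∈ erfWedge v) : r • z ∈ erfWedge v := by
  refine ⟨mul_nonneg hr.le hz.1, fun k => ?_⟩
  calc |(r • z).snd k| = r * |z.snd k| := by simp [abs_mul, abs_of_pos hr]
    _ ≤ r * (v k * z.fst) := mul_le_mul_of_nonneg_left (hz.2 k) hr.le
    _ = v k * (r • z).fst := by simp; ring

lemma measurableSet_erfWedge [Finite ι] (v : ι → ℝ) : MeasurableSet (erfWedge v) := by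
  simp only [erfWedge, Set.ofPred_and, Set.ofPred_forall]
  refine (IsClosed.inter ?_ (isClosed_iInter fun k => ?_)).measurableSet
  · exact isClosed_le continuous_const (by fun_prop)
  · exact isClosed_le (by fun_prop) (by fun_prop)

lemma span_erfWedge [Finite ι] {v : ι → ℝ} (hv : ∀ k, 0 < v k) :
    Submodule.span ℝ (erfWedge v) = ⊤ := by
  cases nonempty_fintype ι
  refine eq_top_iff.2 fun z _ => ?_
  set R := ∑ k, |z.snd k| / v k
  have hR : ∀ k, |z.snd k| ≤ v k * R := fun k => by
    rw [← div_le_iff₀' (hv k)]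
    exact Finset.single_le_sum (f := fun k => |z.snd k| / v k)
      (fun k _ => div_nonneg (abs_nonneg _) (hv k).le) (Finset.mem_univ k)
  have hR0 : 0 ≤ R := Finset.sum_nonneg fun k _ => div_nonneg (abs_nonneg _) (hv k).le
  set axis : WithLp 2 (ℝ × EuclideanSpace ℝ ι) := WithLp.toLp 2 (|z.fst| + R, 0)
  have haxis : axis ∈ erfWedge v := by
    refine ⟨add_nonneg (abs_nonneg _) hR0, fun k => ?_⟩
    change |(0 : ℝ)| ≤ v k * (|z.fst| + R)
    rw [abs_zero]
    exact mul_nonneg (hv k).le (add_nonneg (abs_nonneg _) hR0)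
  have hfst : R ≤ z.fst + (|z.fst| + R) := by linarith [neg_abs_le z.fst]
  have hadd : z + axis ∈ erfWedge v := by
    refine ⟨hR0.trans hfst, fun k => ?_⟩
    change |z.snd k + 0| ≤ v k * (z.fst + (|z.fst| + R))
    rw [add_zero]
    exact (hR k).trans (mul_le_mul_of_nonneg_left hfst (hv k).le)
  rw [← add_sub_cancel_right z axis]
  exact Submodule.sub_mem _ (Submodule.subset_span hadd) (Submodule.subset_span haxis)

variable [Fintype ι]

lemma exp_neg_norm_sq_euclideanSpace (y : EuclideanSpace ℝ ι) :
    Real.exp (-‖y‖ ^ 2) = ∏ k, Real.exp (-(y k) ^ 2) := by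
  simp [EuclideanSpace.norm_sq_eq, ← Real.exp_sum]

lemma setIntegral_box_exp_neg_norm_sq {b : ι → ℝ} (hb : ∀ k, 0 ≤ b k) :
    ∫ y in {y : EuclideanSpace ℝ ι | ∀ k, |y k| ≤ b k}, Real.exp (-‖y‖ ^ 2) =
      √Real.pi ^ Fintype.card ι * ∏ k, erfG (b k) := by
  have hbox : {y : EuclideanSpace ℝ ι | ∀ k, |y k| ≤ b k} =
      WithLp.ofLp ⁻¹' (Set.univ.pi fun k => Set.Icc (-b k) (b k)) := by
    ext y
    simp only [Set.mem_ofPred_eq, Set.mem_preimage, Set.mem_univ_pi, Set.mem_Icc, abs_le]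
  simp only [exp_neg_norm_sq_euclideanSpace]
  rw [hbox, (PiLp.volume_preserving_ofLp ι).setIntegral_preimage_emb
    (MeasurableEquiv.toLp 2 (ι → ℝ)).symm.measurableEmbedding
    (fun y => ∏ k, Real.exp (-(y k) ^ 2)), volume_pi, Measure.restrict_pi_pi,
    integral_fintype_prod_eq_prod (fun _ t => Real.exp (-t ^ 2))]
  simp only [integral_Icc_exp_neg_sq (hb _), Finset.prod_mul_distrib, Finset.prod_const,
    Finset.card_univ]

lemma exp_neg_norm_sq_prod (z : WithLp 2 (ℝ × EuclideanSpace ℝ ι)) :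
    Real.exp (-‖z‖ ^ 2) = Real.exp (-z.fst ^ 2) * Real.exp (-‖z.snd‖ ^ 2) := by
  rw [WithLp.prod_norm_sq_eq_of_L2, ← Real.exp_add, Real.norm_eq_abs, sq_abs, neg_add]

lemma integral_erfWedge_slice {v : ι → ℝ} (hv : ∀ k, 0 ≤ v k) (a : ℝ) :
    ∫ y, (erfWedge v).indicator (fun z => Real.exp (-‖z‖ ^ 2)) (WithLp.toLp 2 (a, y)) =
      (Set.Ici 0).indicator (fun a => √Real.pi ^ Fintype.card ι *
        (Real.exp (-a ^ 2) * ∏ k, erfG (v k * a))) a := by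
  by_cases ha : 0 ≤ a
  · have hslice : ∀ y, (erfWedge v).indicator (fun z => Real.exp (-‖z‖ ^ 2)) (WithLp.toLp 2 (a, y))
        = {y : EuclideanSpace ℝ ι | ∀ k, |y k| ≤ v k * a}.indicator
          (fun y => Real.exp (-a ^ 2) * Real.exp (-‖y‖ ^ 2)) y := fun y => by
      simp [Set.indicator_apply, erfWedge, ha, exp_neg_norm_sq_prod]
    have hbox : MeasurableSet {y : EuclideanSpace ℝ ι | ∀ k, |y k| ≤ v k * a} := by
      measurability
    simp only [hslice]
    rw [integral_indicator hbox, integral_const_mul,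
      setIntegral_box_exp_neg_norm_sq fun k => mul_nonneg (hv k) ha,
      Set.indicator_of_mem (by exact ha)]
    ring
  · simp [erfWedge, ha]

lemma setIntegral_erfWedge {v : ι → ℝ} (hv : ∀ k, 0 ≤ v k) :
    ∫ z in erfWedge v, Real.exp (-‖z‖ ^ 2) = √Real.pi ^ Fintype.card ι *
      ∫ a in Set.Ioi 0, Real.exp (-a ^ 2) * ∏ k, erfG (v k * a) := by
  have hmp := WithLp.volume_preserving_toLp ℝ (EuclideanSpace ℝ ι)
  have hme := (MeasurableEquiv.toLp 2 (ℝ × EuclideanSpace ℝ ι)).measurableEmbedding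
  have hint : Integrable fun p : ℝ × EuclideanSpace ℝ ι =>
      (erfWedge v).indicator (fun z => Real.exp (-‖z‖ ^ 2)) (WithLp.toLp 2 p) :=
    (hmp.integrable_comp_emb hme).2
      (integrable_exp_neg_norm_sq.indicator (measurableSet_erfWedge v))
  rw [← integral_indicator (measurableSet_erfWedge v), ← hmp.integral_comp hme,
    Measure.volume_eq_prod, integral_prod _ hint]
  simp only [integral_erfWedge_slice hv]
  rw [integral_indicator measurableSet_Ici, integral_Ici_eq_integral_Ioi, integral_const_mul]

lemma gaussian_erfWedge_eq {v : ι → ℝ} (hv : ∀ k, 0 ≤ v k) :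
    (∫ z in erfWedge v, Real.exp (-‖z‖ ^ 2)) /
        ∫ z : WithLp 2 (ℝ × EuclideanSpace ℝ ι), Real.exp (-‖z‖ ^ 2) =
      (√Real.pi)⁻¹ * ∫ a in Set.Ioi 0, Real.exp (-a ^ 2) * ∏ k, erfG (v k * a) := by
  have hdim : Module.finrank ℝ (WithLp 2 (ℝ × EuclideanSpace ℝ ι)) = Fintype.card ι + 1 := by
    rw [(WithLp.linearEquiv 2 ℝ (ℝ × EuclideanSpace ℝ ι)).finrank_eq]
    simp [add_comm]
  have hpi : √Real.pi ^ Fintype.card ι ≠ 0 := by positivity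
  rw [setIntegral_erfWedge hv, integral_exp_neg_norm_sq, hdim, pow_succ,
    mul_div_mul_left _ _ hpi, div_eq_inv_mul]

end Wedge

/-! ### Normal cones of the skewed cross-polytope -/

section NormalCone

variable {n : ℕ} {w : Fin n → ℝ} {L : Finset (Fin n)} {σ : Fin n → ℤˣ}

lemma abs_intCast_unit (s : ℤˣ) : |((s : ℤ) : ℝ)| = 1 := by
  rcases Int.units_eq_one_or s with rfl | rfl <;> simp

lemma intCast_unit_mul_self (s : ℤˣ) : ((s : ℤ) : ℝ) * ((s : ℤ) : ℝ) = 1 := by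
  rcases Int.units_eq_one_or s with rfl | rfl <;> simp

lemma inner_single_eq_mul {ι : Type*} [Fintype ι] [DecidableEq ι] (u : EuclideanSpace ℝ ι) (k : ι)
    (a : ℝ) :
    inner ℝ u (EuclideanSpace.single k a) = a * u k := by
  simp [EuclideanSpace.inner_single_right]

lemma inner_le_of_abs_le {u y : EuclideanSpace ℝ (Fin n)} {s : ℝ} (hs : 0 ≤ s)
    (hu : ∀ k, |u k| ≤ w k * s) (hy : y ∈ skewedCrossPolytope w) : inner ℝ u y ≤ s :=
  calc inner ℝ u y = ∑ k, u k * y k := by simp [PiLp.inner_apply, mul_comm]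
    _ ≤ ∑ k, s * (w k * |y k|) := Finset.sum_le_sum fun k _ => by
        calc u k * y k ≤ |u k| * |y k| := (le_abs_self _).trans_eq (abs_mul _ _)
          _ ≤ w k * s * |y k| := mul_le_mul_of_nonneg_right (hu k) (abs_nonneg _)
          _ = s * (w k * |y k|) := by ring
    _ = s * ∑ k, w k * |y k| := by rw [Finset.mul_sum]
    _ ≤ s := mul_le_of_le_one_right hs hy

lemma single_mem_skewedCrossPolytope {k : Fin n} (hw : 0 < w k) (s : ℤˣ) :
    EuclideanSpace.single k (((s : ℤ) : ℝ) / w k) ∈ skewedCrossPolytope w := by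
  change ∑ i, w i * |EuclideanSpace.single k (((s : ℤ) : ℝ) / w k) i| ≤ 1
  rw [Finset.sum_eq_single k (fun i _ hi => by simp [hi]) (by simp), PiLp.single_apply,
    if_pos rfl, abs_div, abs_intCast_unit, abs_of_pos hw, mul_one_div_cancel hw.ne']

lemma abs_le_of_forall_inner_le (hw : ∀ k, 0 < w k) {u : EuclideanSpace ℝ (Fin n)} {s : ℝ}
    (h : ∀ y ∈ skewedCrossPolytope w, inner ℝ u y ≤ s) (k : Fin n) : |u k| ≤ w k * s := by
  have hpos := h _ (single_mem_skewedCrossPolytope (hw k) 1)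
  have hneg := h _ (single_mem_skewedCrossPolytope (hw k) (-1))
  rw [inner_single_eq_mul, div_mul_eq_mul_div, div_le_iff₀' (hw k)] at hpos hneg
  exact abs_le'.2 ⟨by simpa using hpos, by simpa using hneg⟩

lemma convex_skewedCrossPolytope (hw : ∀ k, 0 ≤ w k) : Convex ℝ (skewedCrossPolytope w) := by
  intro x hx y hy a b ha hb hab
  have habs : ∀ k, |(a • x + b • y) k| ≤ a * |x k| + b * |y k| := fun k => by
    simpa [abs_mul, abs_of_nonneg ha, abs_of_nonneg hb] using abs_add_le (a * x k) (b * y k)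
  calc ∑ k, w k * |(a • x + b • y) k|
      ≤ ∑ k, (a * (w k * |x k|) + b * (w k * |y k|)) := Finset.sum_le_sum fun k _ => by
        calc w k * |(a • x + b • y) k| ≤ w k * (a * |x k| + b * |y k|) :=
              mul_le_mul_of_nonneg_left (habs k) (hw k)
          _ = a * (w k * |x k|) + b * (w k * |y k|) := by ring
    _ = a * ∑ k, w k * |x k| + b * ∑ k, w k * |y k| := by
        rw [Finset.sum_add_distrib, Finset.mul_sum, Finset.mul_sum]
    _ ≤ a * 1 + b * 1 :=
        add_le_add (mul_le_mul_of_nonneg_left hx ha) (mul_le_mul_of_nonneg_left hy hb)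
    _ = 1 := by rw [mul_one, mul_one, hab]

lemma single_mem_skewedFace {k : Fin n} (hk : k ∈ L) :
    EuclideanSpace.single k (((σ k : ℤ) : ℝ) / w k) ∈ skewedFace w L σ :=
  subset_convexHull ℝ _ ⟨k, hk, rfl⟩

lemma skewedFace_subset (hw : ∀ k, 0 < w k) : skewedFace w L σ ⊆ skewedCrossPolytope w := by
  refine convexHull_min ?_ (convex_skewedCrossPolytope fun k => (hw k).le)
  rintro _ ⟨k, -, rfl⟩
  exact single_mem_skewedCrossPolytope (hw k) (σ k)

lemma inner_eq_of_mem_skewedFace (hw : ∀ k, w k ≠ 0) {u x : EuclideanSpace ℝ (Fin n)} {s : ℝ}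
    (hu : ∀ k ∈ L, u k = ((σ k : ℤ) : ℝ) * (w k * s)) (hx : x ∈ skewedFace w L σ) :
    inner ℝ u x = s := by
  refine convexHull_min ?_ (convex_hyperplane (innerₗ _ u).isLinear s) hx
  rintro _ ⟨k, hk, rfl⟩
  change inner ℝ u _ = s
  rw [inner_single_eq_mul, hu k hk, div_mul_eq_mul_div, ← mul_assoc, intCast_unit_mul_self, one_mul,
    mul_div_cancel_left₀ _ (hw k)]

lemma skewedFace_ne (hw : ∀ k, w k ≠ 0) : skewedFace w L σ ≠ skewedCrossPolytope w := by
  intro h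
  have hzero : (0 : EuclideanSpace ℝ (Fin n)) ∈ skewedFace w L σ := by
    rw [h]
    simp [skewedCrossPolytope]
  have hone := inner_eq_of_mem_skewedFace (s := 1)
    (u := WithLp.toLp 2 fun k => ((σ k : ℤ) : ℝ) * (w k * 1)) hw (fun _ _ => rfl) hzero
  simp at hone

lemma mem_outwardNormalCone_iff (hw : ∀ k, 0 < w k) (hL : L.Nonempty)
    {u : EuclideanSpace ℝ (Fin n)} :
    u ∈ outwardNormalCone (skewedFace w L σ) (skewedCrossPolytope w) ↔
      ∃ s, 0 ≤ s ∧ (∀ k ∈ L, u k = ((σ k : ℤ) : ℝ) * (w k * s)) ∧ ∀ k, |u k| ≤ w k * s := by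
  constructor
  · intro hu
    obtain ⟨k₀, hk₀⟩ := hL
    set s := inner ℝ u (EuclideanSpace.single k₀ (((σ k₀ : ℤ) : ℝ) / w k₀))
    have hsupport : ∀ x ∈ skewedFace w L σ, inner ℝ u x = s := fun x hx =>
      le_antisymm (hu _ (single_mem_skewedFace hk₀) _ (skewedFace_subset hw hx))
        (hu _ hx _ (skewedFace_subset hw (single_mem_skewedFace hk₀)))
    refine ⟨s, ?_, fun k hk => ?_, abs_le_of_forall_inner_le hw (hu _ (single_mem_skewedFace hk₀))⟩
    · simpa using hu _ (single_mem_skewedFace hk₀) 0 (by simp [skewedCrossPolytope])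
    · have hvertex := hsupport _ (single_mem_skewedFace hk)
      rw [inner_single_eq_mul, div_mul_eq_mul_div, div_eq_iff (hw k).ne', mul_comm s] at hvertex
      rw [← hvertex, ← mul_assoc, intCast_unit_mul_self, one_mul]
  · rintro ⟨s, hs, heq, hle⟩ x hx y hy
    rw [inner_eq_of_mem_skewedFace (fun k => (hw k).ne') heq hx]
    exact inner_le_of_abs_le hs hle hy

end NormalCone

/-! ### External angles as Gaussian–erf integrals -/

section Glue

variable {ι : Type*} [DecidableEq ι] {L : Finset ι} {ν : ι → ℝ}

/-- The linear map that sends `(a, y)` to the vector equal to `a • ν` on `L` and to `y` off `L`. -/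
noncomputable def glueOn (L : Finset ι) (ν : ι → ℝ) :
    WithLp 2 (ℝ × EuclideanSpace ℝ {k // k ∉ L}) →ₗ[ℝ] EuclideanSpace ℝ ι where
  toFun z := WithLp.toLp 2 fun k => if h : k ∈ L then z.fst * ν k else z.snd ⟨k, h⟩
  map_add' x y := by
    ext k
    by_cases h : k ∈ L <;> simp [h, add_mul]
  map_smul' r x := by
    ext k
    by_cases h : k ∈ L <;> simp [h, mul_assoc]

lemma glueOn_apply_of_mem (z : WithLp 2 (ℝ × EuclideanSpace ℝ {k // k ∉ L})) {k : ι} (h : k ∈ L) :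
    glueOn L ν z k = z.fst * ν k := by
  simp [glueOn, h]

lemma glueOn_apply_of_notMem (z : WithLp 2 (ℝ × EuclideanSpace ℝ {k // k ∉ L})) {k : ι}
    (h : k ∉ L) : glueOn L ν z k = z.snd ⟨k, h⟩ := by
  simp [glueOn, h]

variable [Fintype ι]

lemma norm_glueOn (hν : ∑ k ∈ L, ν k ^ 2 = 1) (z : WithLp 2 (ℝ × EuclideanSpace ℝ {k // k ∉ L})) :
    ‖glueOn L ν z‖ = ‖z‖ := by
  have hL : ∑ k ∈ L, glueOn L ν z k ^ 2 = z.fst ^ 2 := by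
    calc ∑ k ∈ L, glueOn L ν z k ^ 2 = ∑ k ∈ L, z.fst ^ 2 * ν k ^ 2 :=
          Finset.sum_congr rfl fun k hk => by rw [glueOn_apply_of_mem z hk, mul_pow]
      _ = z.fst ^ 2 := by rw [← Finset.mul_sum, hν, mul_one]
  have hLc : ∑ k ∈ Lᶜ, glueOn L ν z k ^ 2 = ∑ k, z.snd k ^ 2 := by
    rw [Finset.sum_subtype (F := inferInstance) Lᶜ (p := fun k => k ∉ L) (by simp)]
    exact Finset.sum_congr rfl fun k _ => by rw [glueOn_apply_of_notMem z k.2]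
  rw [← sq_eq_sq₀ (norm_nonneg _) (norm_nonneg _), EuclideanSpace.norm_sq_eq,
    WithLp.prod_norm_sq_eq_of_L2, EuclideanSpace.norm_sq_eq]
  simp only [Real.norm_eq_abs, sq_abs]
  rw [← Finset.sum_add_sum_compl L, hL, hLc]

/-- `glueOn L ν` as a linear isometry, for `ν` of norm one on `L`. -/
noncomputable def glueOnIsometry (hν : ∑ k ∈ L, ν k ^ 2 = 1) :
    WithLp 2 (ℝ × EuclideanSpace ℝ {k // k ∉ L}) →ₗᵢ[ℝ] EuclideanSpace ℝ ι where
  toLinearMap := glueOn L ν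
  norm_map' := norm_glueOn hν

end Glue

section ExternalAngle

variable {n : ℕ} {w : Fin n → ℝ} {L : Finset (Fin n)} {σ : Fin n → ℤˣ}

lemma outwardNormalCone_eq_image_erfWedge (hw : ∀ k, 0 < w k) (hL : L.Nonempty) {r : ℝ}
    (hr : 0 < r) :
    outwardNormalCone (skewedFace w L σ) (skewedCrossPolytope w) =
      glueOn L (fun k => ((σ k : ℤ) : ℝ) * (w k / r)) '' erfWedge fun k => w k / r := by
  ext u
  rw [mem_outwardNormalCone_iff hw hL]
  constructor
  · rintro ⟨s, hs, heq, hle⟩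
    have hscale : ∀ k, w k / r * (r * s) = w k * s := fun k => by field_simp
    refine ⟨WithLp.toLp 2 (r * s, WithLp.toLp 2 fun k => u k),
      ⟨mul_nonneg hr.le hs, fun k => (hle k).trans_eq (hscale k).symm⟩, ?_⟩
    ext k
    by_cases hk : k ∈ L
    · rw [glueOn_apply_of_mem _ hk, heq k hk, ← hscale k]
      change r * s * _ = _
      ring
    · exact glueOn_apply_of_notMem _ hk
  · rintro ⟨z, ⟨hz, hle⟩, rfl⟩
    have hs : 0 ≤ z.fst / r := div_nonneg hz hr.le
    have heq : ∀ k ∈ L, glueOn L (fun k => ((σ k : ℤ) : ℝ) * (w k / r)) z k =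
        ((σ k : ℤ) : ℝ) * (w k * (z.fst / r)) := fun k hk => by
      rw [glueOn_apply_of_mem z hk]
      ring
    refine ⟨z.fst / r, hs, heq, fun k => ?_⟩
    by_cases hk : k ∈ L
    · rw [heq k hk, abs_mul, abs_intCast_unit, one_mul, abs_of_nonneg (mul_nonneg (hw k).le hs)]
    · rw [glueOn_apply_of_notMem z hk, mul_div_left_comm, mul_comm]
      exact hle ⟨k, hk⟩

theorem externalAngle_skewedFace (hw : ∀ k, 0 < w k) (hL : L.Nonempty) :
    externalAngle (skewedFace w L σ) (skewedCrossPolytope w) =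
      √((∑ k ∈ L, w k ^ 2) / Real.pi) * ∫ s in Set.Ioi (0 : ℝ),
        Real.exp (-((∑ k ∈ L, w k ^ 2) * s ^ 2)) * ∏ k ∈ Lᶜ, erfG (w k * s) := by
  have hA : 0 < ∑ k ∈ L, w k ^ 2 := Finset.sum_pos (fun k _ => pow_pos (hw k) 2) hL
  set A := ∑ k ∈ L, w k ^ 2
  have hr : 0 < √A := Real.sqrt_pos.2 hA
  have hν : ∑ k ∈ L, (((σ k : ℤ) : ℝ) * (w k / √A)) ^ 2 = 1 := by
    simp only [mul_pow, div_pow, Real.sq_sqrt hA.le, sq ((σ _ : ℤ) : ℝ), intCast_unit_mul_self,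
      one_mul]
    rw [← Finset.sum_div, div_self hA.ne']
  have hv : ∀ k : {k // k ∉ L}, 0 < w k / √A := fun k => div_pos (hw k) hr
  have hprod : ∀ s, ∏ k ∈ Lᶜ, erfG (w k * s) =
      ∏ k : {k // k ∉ L}, erfG (w k / √A * (√A * s)) := fun s => by
    rw [Finset.prod_subtype (F := inferInstance) Lᶜ (p := fun k => k ∉ L) (by simp)]
    exact Finset.prod_congr rfl fun k _ => by rw [← mul_assoc, div_mul_cancel₀ _ hr.ne']
  have hexp : ∀ s, A * s ^ 2 = (√A * s) ^ 2 := fun s => by rw [mul_pow, Real.sq_sqrt hA.le]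
  have hsubst := integral_comp_mul_left_Ioi
    (fun a => Real.exp (-a ^ 2) * ∏ k : {k // k ∉ L}, erfG (w k / √A * a)) 0 hr
  rw [mul_zero, smul_eq_mul] at hsubst
  simp only [hprod, hexp]
  rw [hsubst, externalAngle, if_neg (skewedFace_ne fun k => (hw k).ne'),
    if_pos (skewedFace_subset hw), outwardNormalCone_eq_image_erfWedge hw hL hr]
  refine ((sphereFraction_image_eq_gaussian (measurableSet_erfWedge _)
    (fun _ ht _ hz => smul_mem_erfWedge ht hz) (span_erfWedge hv) (glueOnIsometry hν)).trans
    (gaussian_erfWedge_eq fun k => (hv k).le)).trans ?_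
  rw [Real.sqrt_div hA.le]
  field_simp

theorem externalAngle_skewedFace_comp {κ : Type*} [Fintype κ] [DecidableEq κ] {w : κ → ℝ}
    (hw : ∀ i, 0 < w i) (c : Fin n → κ) (hL : L.Nonempty) :
    externalAngle (skewedFace (fun k => w (c k)) L σ) (skewedCrossPolytope fun k => w (c k)) =
      gaussianErfIntegral (∑ i, ({k ∈ L | c k = i}.card : ℝ) * w i ^ 2)
        (fun i => ({k ∈ Lᶜ | c k = i}.card : ℝ)) w := by
  have hA : ∑ k ∈ L, w (c k) ^ 2 = ∑ i, ({k ∈ L | c k = i}.card : ℝ) * w i ^ 2 := by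
    rw [← Finset.sum_fiberwise' L c fun i => w i ^ 2]
    simp only [Finset.sum_const, nsmul_eq_mul]
  rw [externalAngle_skewedFace (fun k => hw (c k)) hL, hA, gaussianErfIntegral]
  congr 1
  refine setIntegral_congr_fun measurableSet_Ioi fun s hs => ?_
  have hG : ∀ i, 0 < erfG (w i * s) := fun i => erfG_pos (mul_pos (hw i) hs)
  have hprod : ∏ k ∈ Lᶜ, erfG (w (c k) * s) =
      Real.exp (∑ i, ({k ∈ Lᶜ | c k = i}.card : ℝ) * Real.log (erfG (w i * s))) := by
    rw [← Finset.prod_fiberwise' Lᶜ c fun i => erfG (w i * s), Real.exp_sum]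
    simp only [Finset.prod_const, Real.exp_nat_mul, Real.exp_log (hG _)]
  change Real.exp _ * _ = Real.exp (-erfExponent _ _ _ s)
  rw [hprod, ← Real.exp_add, erfExponent, neg_sub, neg_add_eq_sub]

end ExternalAngle

/-! ### Decay of external angles -/

theorem theorem1_general {ι : Type*} [Fintype ι] [DecidableEq ι] {w a D : ι → ℝ}
    (hw : ∀ i, 0 < w i) (hC : 0 < ∑ i, a i * w i ^ 2) (hD : ∀ i, 0 ≤ D i)
    (hDsum : 0 < ∑ i, D i) :
    ∃ x₀ : ℝ, 0 < x₀ ∧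
      (∀ x : ℝ, 0 < x → (2 * ∑ i, a i * w i ^ 2 -
        ∑ i, w i * erfDensity (w i * x) * D i / (x * erfG (w i * x)) = 0 ↔ x = x₀)) ∧
      ∀ (n : ℕ → ℕ) (c : ∀ j, Fin (n j) → ι) (L : ∀ j, Finset (Fin (n j)))
        (σ : ∀ j, Fin (n j) → ℤˣ),
        Tendsto n atTop atTop →
        (∀ i, Tendsto (fun j => ({k ∈ L j | c j k = i}.card : ℝ) / n j) atTop (𝓝 (a i))) →
        (∀ i, Tendsto (fun j => ({k ∈ (L j)ᶜ | c j k = i}.card : ℝ) / n j) atTop (𝓝 (D i))) →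
        Tendsto
          (fun j => -(Real.log (externalAngle (skewedFace (fun k => w (c j k)) (L j) (σ j))
            (skewedCrossPolytope fun k => w (c j k))) / n j))
          atTop
          (𝓝 ((∑ i, a i * w i ^ 2) * x₀ ^ 2 - ∑ i, D i * Real.log (erfG (w i * x₀)))) := by
  set C := ∑ i, a i * w i ^ 2
  obtain ⟨x₀, hx₀, hsaddle⟩ := exists_saddleRatio_eq hw hD hDsum (mul_pos two_pos hC)
  refine ⟨x₀, hx₀, fun x hx => ?_, fun n c L σ hn hL hLc => ?_⟩
  · rw [← saddleRatio_eq_sum hw, sub_eq_zero, eq_comm, ← hsaddle]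
    exact (strictAntiOn_saddleRatio hw hD hDsum).injOn.eq_iff hx hx₀
  have hN : Tendsto (fun j => (n j : ℝ)) atTop atTop := tendsto_natCast_atTop_atTop.comp hn
  have hA : Tendsto (fun j => (∑ i, ({k ∈ L j | c j k = i}.card : ℝ) * w i ^ 2) / n j) atTop
      (𝓝 C) := by
    simp only [Finset.sum_div, mul_div_right_comm]
    exact tendsto_finsetSum _ fun i _ => (hL i).mul_const _
  have hnonempty : ∀ᶠ j in atTop, (L j).Nonempty := by
    filter_upwards [eventually_pos_of_tendsto_div hC hN hA] with j hj
    contrapose! hj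
    simp [hj]
  refine (tendsto_neg_log_gaussianErfIntegral hw hC hD hx₀
    (isMinOn_erfExponent hw hD hDsum hx₀ hsaddle) hN (fun _ _ => Nat.cast_nonneg _) hA
    hLc).congr' ?_
  filter_upwards [hnonempty] with j hj
  rw [externalAngle_skewedFace_comp hw (c j) hj]

lemma tendsto_card_compl_div {n : ℕ → ℕ} {K : ∀ j, Finset (Fin (n j))} {γ : ℝ}
    (hn : Tendsto n atTop atTop)
    (hK : Tendsto (fun j => ((K j).card : ℝ) / n j) atTop (𝓝 γ)) :
    Tendsto (fun j => (((K j)ᶜ).card : ℝ) / n j) atTop (𝓝 (1 - γ)) := by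
  refine (hK.const_sub 1).congr' ?_
  filter_upwards [hn.eventually_gt_atTop 0] with j hj
  have hj' : (n j : ℝ) ≠ 0 := by positivity
  rw [Finset.card_compl, Nat.cast_sub (Finset.card_le_univ _), Fintype.card_fin, sub_div,
    div_self hj']

lemma tendsto_card_inter_div {n : ℕ → ℕ} {K L : ∀ j, Finset (Fin (n j))} {γ P t : ℝ}
    (hK : Tendsto (fun j => ((K j).card : ℝ) / n j) atTop (𝓝 γ))
    (hL : Tendsto (fun j => ((L j ∩ K j).card - ((K j).card : ℝ) * P) / n j) atTop (𝓝 t)) :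
    Tendsto (fun j => ((L j ∩ K j).card : ℝ) / n j) atTop (𝓝 (t + γ * P)) :=
  (hL.add (hK.mul_const P)).congr fun j => by ring

lemma tendsto_card_compl_inter_div {n : ℕ → ℕ} {K L : ∀ j, Finset (Fin (n j))} {γ P t : ℝ}
    (hK : Tendsto (fun j => ((K j).card : ℝ) / n j) atTop (𝓝 γ))
    (hL : Tendsto (fun j => ((L j ∩ K j).card - ((K j).card : ℝ) * P) / n j) atTop (𝓝 t)) :
    Tendsto (fun j => (((L j)ᶜ ∩ K j).card : ℝ) / n j) atTop (𝓝 (γ * (1 - P) - t)) := by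
  refine ((hK.mul_const (1 - P)).sub hL).congr fun j => ?_
  have hcard : ((L j ∩ K j).card : ℝ) + ((L j)ᶜ ∩ K j).card = (K j).card := by
    rw [Finset.inter_comm, Finset.inter_comm _ (K j), ← Finset.sdiff_eq_inter_compl]
    exact_mod_cast Finset.card_inter_add_card_sdiff (K j) (L j)
  rw [← hcard]
  ring

/-- The index in `Fin 2` of the part of the partition `{K, Kᶜ}` that contains `k`. -/
def weightClass {n : ℕ} (K : Finset (Fin n)) (k : Fin n) : Fin 2 := if k ∈ K then 0 else 1

lemma filter_weightClass {n : ℕ} (K S : Finset (Fin n)) (i : Fin 2) :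
    {k ∈ S | weightClass K k = i} = S ∩ ![K, Kᶜ] i := by
  ext k
  fin_cases i <;> by_cases hk : k ∈ K <;> simp [weightClass, hk]

lemma twoWeights_eq_weightClass {n : ℕ} (K : Finset (Fin n)) (W : ℝ) :
    twoWeights K W = fun k => ![1, W] (weightClass K k) := by
  ext k
  by_cases hk : k ∈ K <;> simp [twoWeights, weightClass, hk]

theorem theorem1
    (γ₁ γ₂ P₁ P₂ t₁ t₂ W C D₁ D₂ : ℝ)
    (hγ₁ : 0 ≤ γ₁) (hγ₂ : 0 ≤ γ₂) (hγ : γ₁ + γ₂ = 1)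
    (hP₁ : P₁ ∈ Set.Icc (0 : ℝ) 1) (hP₂ : P₂ ∈ Set.Icc (0 : ℝ) 1)
    (ht₁ : t₁ ∈ Set.Icc 0 (γ₁ * (1 - P₁))) (ht₂ : t₂ ∈ Set.Icc 0 (γ₂ * (1 - P₂)))
    (hW : 0 < W)
    (hC : C = (t₁ + γ₁ * P₁) + W ^ 2 * (t₂ + γ₂ * P₂))
    (hD₁ : D₁ = γ₁ * (1 - P₁) - t₁) (hD₂ : D₂ = γ₂ * (1 - P₂) - t₂)
    -- the faces are not asymptotically empty, and not asymptotically facets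
    (hCpos : 0 < C) (hDpos : 0 < D₁ + D₂) :
    ∃ x₀ : ℝ, 0 < x₀ ∧
      (∀ x : ℝ, 0 < x →
        (2 * C - erfDensity x * D₁ / (x * erfG x)
          - W * erfDensity (W * x) * D₂ / (x * erfG (W * x)) = 0 ↔ x = x₀)) ∧
      -- every sequence of dimensions `n j → ∞`, index sets `K₁ j` (with complement `K₂ j`),
      -- and faces with support `L j` and signs `σ j`, in the proportions given above
      ∀ (n : ℕ → ℕ) (K₁ L : ∀ j, Finset (Fin (n j))) (σ : ∀ j, Fin (n j) → ℤˣ),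
        Tendsto n atTop atTop →
        Tendsto (fun j => ((K₁ j).card : ℝ) / n j) atTop (𝓝 γ₁) →
        Tendsto (fun j => ((L j ∩ K₁ j).card - (K₁ j).card * P₁) / n j) atTop (𝓝 t₁) →
        Tendsto (fun j => ((L j ∩ (K₁ j)ᶜ).card - ((K₁ j)ᶜ.card : ℝ) * P₂) / n j)
          atTop (𝓝 t₂) →
        Tendsto
          (fun j => -(Real.log (externalAngle
              (skewedFace (twoWeights (K₁ j) W) (L j) (σ j))
              (skewedCrossPolytope (twoWeights (K₁ j) W))) / n j))
          atTop
          (𝓝 (C * x₀ ^ 2 - D₁ * Real.log (erfG x₀) - D₂ * Real.log (erfG (W * x₀)))) := by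
  have hD : ∀ i, 0 ≤ ![D₁, D₂] i :=
    Fin.forall_fin_two.2 ⟨hD₁ ▸ sub_nonneg.2 ht₁.2, hD₂ ▸ sub_nonneg.2 ht₂.2⟩
  have hC_sum : ∑ i, ![t₁ + γ₁ * P₁, t₂ + γ₂ * P₂] i * ![1, W] i ^ 2 = C := by
    simp [hC, mul_comm]
  obtain ⟨x₀, hx₀, hroot, hlim⟩ := theorem1_general (w := ![1, W])
    (by simp [Fin.forall_fin_two, hW]) (hC_sum ▸ hCpos) hD (by simpa using hDpos)
  rw [hC_sum] at hroot hlim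
  simp only [Fin.sum_univ_two, Matrix.cons_val_zero, Matrix.cons_val_one, one_mul,
    ← sub_sub] at hroot hlim
  refine ⟨x₀, hx₀, hroot, fun n K₁ L σ hn hK₁ hL₁ hL₂ => ?_⟩
  have hK₂ : Tendsto (fun j => (((K₁ j)ᶜ).card : ℝ) / n j) atTop (𝓝 γ₂) :=
    eq_sub_of_add_eq' hγ ▸ tendsto_card_compl_div hn hK₁
  simp only [twoWeights_eq_weightClass]
  refine hlim n (fun j => weightClass (K₁ j)) L σ hn ?_ ?_ <;>
    simp only [filter_weightClass, Fin.forall_fin_two]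
  · exact ⟨tendsto_card_inter_div hK₁ hL₁, tendsto_card_inter_div hK₂ hL₂⟩
  · exact ⟨hD₁ ▸ tendsto_card_compl_inter_div hK₁ hL₁, hD₂ ▸ tendsto_card_compl_inter_div hK₂ hL₂⟩
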